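/- A ring $S$ with identity is called nil-clean if for every $a \in S$ there is an idempotent $e \in S$ such that $a - e$ is nilpotent. Let $R$ be a commutative ring with identity and let $n \ge 1$ be an integer. Then $R$ is nil-clean if and only if the ring $M_n(R)$ of all $n \times n$ matrices over $R$ is nil-clean. -/

import Mathlib

/-- An element `a` of a ring `R` is nil-clean if there is an idempotent `e` of `R` such that
`a - e` is nilpotent. -/
def IsNilCleanElem {R : Type*} [Ring R] (a : R) : Prop :=
  ∃ e : R, IsIdempotentElem e ∧ IsNilpotent (a - e)

/-- A ring is nil-clean if all of its elements are nil-clean. -/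
def IsNilCleanRing (R : Type*) [Ring R] : Prop :=
  ∀ a : R, IsNilCleanElem a

/-! A commutative ring is nil-clean exactly when it is Boolean modulo its nilradical. If matrices
are nil-clean, scalar matrices, being central, give nilpotent `a ^ 2 - a`
(`IsNilCleanElem.isNilpotent_sq_sub_of_central`), and idempotents lift modulo the nilradical.

Conversely, `Matrix n n R` maps onto matrices over the Boolean ring `R ⧸ nilradical R` with nil
kernel. The entries of one matrix generate a finite Boolean subring, a product of copies of the
field with two elements, so that field suffices. There, induct on dimension (`isNilCleanRing_end`):
a proper invariant subspace gives a block triangular form. Otherwise a trace-adjusted cyclic basis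
makes the last diagonal entry 1, and removing a nilpotent shift leaves an idempotent. -/

theorem IsIdempotentElem.isNilCleanElem {S : Type*} [Ring S] {e : S} (he : IsIdempotentElem e) :
    IsNilCleanElem e :=
  ⟨e, he, by simp⟩

theorem IsNilpotent.isNilCleanElem {S : Type*} [Ring S] {a : S} (ha : IsNilpotent a) :
    IsNilCleanElem a :=
  ⟨0, .zero, by simpa using ha⟩

theorem IsNilCleanElem.map {S T : Type*} [Ring S] [Ring T] (φ : S →+* T) {a : S}
    (ha : IsNilCleanElem a) : IsNilCleanElem (φ a) := by
  obtain ⟨e, he, hn⟩ := ha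
  exact ⟨φ e, he.map φ, by simpa using hn.map φ⟩

theorem IsNilCleanRing.of_surjective {S T : Type*} [Ring S] [Ring T] (hS : IsNilCleanRing S)
    (φ : S →+* T) (hφ : Function.Surjective φ) : IsNilCleanRing T := by
  intro a
  obtain ⟨a, rfl⟩ := hφ a
  exact (hS a).map φ

/-- Nil-clean elements lift along surjections with nil kernel. -/
theorem IsNilCleanElem.of_map {S T : Type*} [Ring S] [Ring T] (φ : S →+* T)
    (hφ : Function.Surjective φ) (hker : ∀ x ∈ RingHom.ker φ, IsNilpotent x) {a : S}
    (ha : IsNilCleanElem (φ a)) : IsNilCleanElem a := by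
  obtain ⟨e, he, k, hk⟩ := ha
  obtain ⟨e, he', rfl⟩ := exists_isIdempotentElem_eq_of_ker_isNilpotent φ hker e (hφ e) he
  obtain ⟨l, hl⟩ := hker ((a - e) ^ k) (by simpa [RingHom.mem_ker] using hk)
  exact ⟨e, he', k * l, by rw [pow_mul, hl]⟩

theorem IsNilCleanRing.pi {ι : Type*} [Finite ι] {S : ι → Type*} [∀ i, Ring (S i)]
    (hS : ∀ i, IsNilCleanRing (S i)) : IsNilCleanRing (∀ i, S i) := by
  intro a
  cases nonempty_fintype ι
  choose e he k hk using fun i => hS i (a i)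
  refine ⟨e, funext he, ∑ i, k i, funext fun i => ?_⟩
  exact pow_eq_zero_of_le (Finset.single_le_sum (fun _ _ => Nat.zero_le _) (Finset.mem_univ i))
    (hk i)

theorem Matrix.pow_apply_mem_ideal_pow {R n : Type*} [CommRing R] [Fintype n] [DecidableEq n]
    {I : Ideal R} {A : Matrix n n R} (hA : ∀ i j, A i j ∈ I) (k : ℕ) (i j : n) :
    (A ^ k) i j ∈ I ^ k := by
  induction k generalizing i j with
  | zero => simp
  | succ k ih =>
    rw [pow_succ, pow_succ, Matrix.mul_apply]
    exact Ideal.sum_mem _ fun l _ => Ideal.mul_mem_mul (ih i l) (hA l j)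

/-- Finitely many nilpotent entries generate a nilpotent ideal, and the entries of `A ^ k` lie in
its `k`-th power. -/
theorem Matrix.isNilpotent_of_forall_apply {R n : Type*} [CommRing R] [Fintype n] [DecidableEq n]
    {A : Matrix n n R} (hA : ∀ i j, IsNilpotent (A i j)) : IsNilpotent A := by
  let s : Set R := Set.range fun p : n × n => A p.1 p.2
  have hfg : (Ideal.span s).FG := Submodule.fg_span (Set.finite_range _)
  have hle : Ideal.span s ≤ nilradical R := by
    rw [Ideal.span_le]
    rintro _ ⟨p, rfl⟩
    exact hA _ _
  obtain ⟨k, hk⟩ := hfg.isNilpotent_iff_le_nilradical.mpr hle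
  refine ⟨k, Matrix.ext fun i j => ?_⟩
  have h := Matrix.pow_apply_mem_ideal_pow (I := Ideal.span s)
    (fun i j => Ideal.subset_span ⟨(i, j), rfl⟩) k i j
  rw [hk] at h
  simpa using h

/-! ### Descent from matrices to the base ring -/

/-- A commutative ring is nil-clean as soon as it is Boolean modulo its nilradical. -/
theorem isNilCleanRing_of_isNilpotent_sq_sub {R : Type*} [CommRing R]
    (h : ∀ a : R, IsNilpotent (a ^ 2 - a)) : IsNilCleanRing R := by
  intro a
  refine .of_map (Ideal.Quotient.mk (nilradical R)) Ideal.Quotient.mk_surjective ?_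
    (IsIdempotentElem.isNilCleanElem ?_)
  · intro x hx
    rwa [Ideal.mk_ker] at hx
  · rw [IsIdempotentElem, ← map_mul, Ideal.Quotient.eq, ← sq]
    exact h a

/-- Since `a` commutes with `e`, `a - e` is a nilpotent factor of `a ^ 2 - a`, and it commutes with
the cofactor `a + e - 1`. -/
theorem IsNilCleanElem.isNilpotent_sq_sub_of_central {S : Type*} [Ring S] {a : S}
    (ha : IsNilCleanElem a) (hc : ∀ x, Commute a x) : IsNilpotent (a ^ 2 - a) := by
  obtain ⟨e, he, hn⟩ := ha
  have hcomm : Commute (a - e) (a + e - 1) :=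
    (((Commute.refl a).add_right (hc e)).sub_right (hc 1)).sub_left
      (((hc e).symm.add_right (Commute.refl e)).sub_right (Commute.one_right e))
  have : a ^ 2 - a = (a - e) * (a + e - 1) := by
    have h1 : a * e = e * a := hc e
    have h2 : e * e = e := he
    simp only [mul_sub, mul_add, sub_mul, mul_one, sq, h1, h2]
    abel
  rw [this]
  exact hcomm.isNilpotent_mul_right hn

theorem isNilCleanRing_of_matrix {R n : Type*} [CommRing R] [Fintype n] [DecidableEq n] [Nonempty n]
    (h : IsNilCleanRing (Matrix n n R)) : IsNilCleanRing R := by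
  refine isNilCleanRing_of_isNilpotent_sq_sub fun a => ?_
  have h1 := (h (Matrix.scalar n a)).isNilpotent_sq_sub_of_central
    fun x => Matrix.scalar_commute a (Commute.all a) x
  rw [← map_pow, ← map_sub] at h1
  refine (IsNilpotent.map_iff (f := Matrix.scalar n) ?_).mp h1
  intro x y hxy
  simpa using hxy

theorem IsNilCleanRing.sq_eq_self_of_isReduced {R : Type*} [CommRing R] [IsReduced R]
    (h : IsNilCleanRing R) (a : R) : a * a = a := by
  have := ((h a).isNilpotent_sq_sub_of_central fun x => Commute.all a x).eq_zero
  rwa [sub_eq_zero, sq] at this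

/-! ### Reduction to the field with two elements -/

/-- Over a Boolean ring, nil-cleanness of matrices may be tested on the residue fields of finite
subrings. -/
theorem isNilCleanRing_matrix_of_boolean.{u, v} {R : Type u} {n : Type v} [CommRing R] [Fintype n] [DecidableEq n]
    (h : ∀ a : R, a * a = a)
    (hfield : ∀ (K : Type u) [Field K], (∀ x : K, x = 0 ∨ x = 1) → IsNilCleanRing (Matrix n n K)) :
    IsNilCleanRing (Matrix n n R) := by
  intro A
  let s : Set R := Set.range fun p : n × n => A p.1 p.2
  let S := Algebra.adjoin ℤ s
  have hS : ∀ a : S, a * a = a := fun a => Subtype.ext (h a)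
  have hfg : Module.Finite ℤ S := Module.Finite.iff_fg.mpr <|
    fg_adjoin_of_finite (Set.finite_range _) fun x _ =>
      ⟨Polynomial.X ^ 2 - Polynomial.X, by monicity!, by simp [sq, h x]⟩
  have hfin : Finite S := by
    refine Module.finite_of_fg_torsion S fun {x} => ⟨⟨2, by simp⟩, ?_⟩
    change (2 : ℤ) • x = 0
    -- Expanding the square gives `4x = 2x`, so 2 kills `S`; a finitely generated torsion abelian
    -- group is finite.
    have h1 := hS (x + x)
    rw [two_zsmul]
    linear_combination h1 - 4 * hS x
  have hred : IsReduced S := isReduced_iff_pow_one_lt 2 one_lt_two |>.mpr fun x hx => by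
    rw [← hS x, ← sq, hx]
  have hpi : IsNilCleanRing (∀ I : MaximalSpectrum S, Matrix n n (S ⧸ I.asIdeal)) := by
    refine .pi fun I => ?_
    let _ : Field (S ⧸ I.asIdeal) := Ideal.Quotient.field I.asIdeal
    refine hfield (S ⧸ I.asIdeal) fun x => ?_
    obtain ⟨x, rfl⟩ := Ideal.Quotient.mk_surjective x
    have : Ideal.Quotient.mk I.asIdeal x * (Ideal.Quotient.mk I.asIdeal x - 1) = 0 := by
      rw [mul_sub, ← map_mul, hS x, mul_one, sub_self]
    rcases mul_eq_zero.mp this with h | h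
    · exact .inl h
    · exact .inr (sub_eq_zero.mp h)
  let φ : (∀ I : MaximalSpectrum S, Matrix n n (S ⧸ I.asIdeal)) →+*
      Matrix n n (∀ I : MaximalSpectrum S, S ⧸ I.asIdeal) :=
    { toFun := fun M => Matrix.of fun i j I => M I i j
      map_one' := by ext i j I; by_cases hij : i = j <;> simp [hij, Matrix.one_apply]
      map_zero' := rfl
      map_add' := fun _ _ => rfl
      map_mul' := fun _ _ => by ext i j I; simp [Matrix.mul_apply] }
  -- A finite reduced commutative ring is the product of its residue fields.
  let ψ : Matrix n n (∀ I : MaximalSpectrum S, S ⧸ I.asIdeal) →+* Matrix n n R :=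
    ((algebraMap S R).comp (IsArtinianRing.equivPi S).symm.toRingEquiv.toRingHom).mapMatrix
  let a (i j : n) : S := ⟨A i j, Algebra.subset_adjoin ⟨(i, j), rfl⟩⟩
  have hA : A = (ψ.comp φ) fun I => Matrix.of fun i j => Ideal.Quotient.mk I.asIdeal (a i j) := by
    ext i j
    change A i j = algebraMap S R ((IsArtinianRing.equivPi S).symm (IsArtinianRing.equivPi S (a i j)))
    rw [AlgEquiv.symm_apply_apply]
    rfl
  rw [hA]
  exact (hpi _).map _

/-! ### Nilpotent and block triangular endomorphisms -/

open Module in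
theorem LinearMap.isNilpotent_of_basis {K V ι : Type*} [Field K] [AddCommGroup V] [Module K V]
    [Finite ι] (b : Basis ι K V) (N : End K V) (h : ∀ i, ∃ k, (N ^ k) (b i) = 0) :
    IsNilpotent N := by
  cases nonempty_fintype ι
  choose k hk using h
  refine ⟨∑ i, k i, b.ext fun i => ?_⟩
  exact Module.End.pow_map_zero_of_le
    (Finset.single_le_sum (fun _ _ => Nat.zero_le _) (Finset.mem_univ i)) (hk i)

open Module in
theorem LinearMap.isNilpotent_of_basis_fin {K V : Type*} [Field K] [AddCommGroup V] [Module K V]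
    {n : ℕ} (w : ℕ → V) (b : Basis (Fin n) K V) (hb : ∀ i, b i = w i) (N : End K V) (m : ℕ)
    (hm : ∃ k, (N ^ k) (w m) = 0) (hlt : ∀ i < m, (∃ k, (N ^ k) (N (w i)) = 0) ∨ N (w i) = w (i + 1))
    (hn : n ≤ m + 1) :
    IsNilpotent N := by
  refine LinearMap.isNilpotent_of_basis b N fun i => ?_
  rw [hb]
  have key : ∀ j ≤ m, ∃ k, (N ^ k) (w j) = 0 := by
    intro j hj
    induction hj using Nat.decreasingInduction with
    | self => exact hm
    | of_succ j hj ih =>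
      rcases hlt j hj with ⟨k, hk⟩ | h
      · exact ⟨k + 1, by rwa [pow_succ]⟩
      · obtain ⟨k, hk⟩ := ih
        exact ⟨k + 1, by rw [pow_succ, Module.End.mul_apply, h, hk]⟩
  exact key i (by omega)

open Module in
/-- An upper block triangular endomorphism is nil-clean if its diagonal blocks are. -/
theorem isNilCleanElem_end_prod {K V W : Type*} [Field K] [AddCommGroup V] [Module K V]
    [AddCommGroup W] [Module K W] (hV : IsNilCleanRing (End K V)) (hW : IsNilCleanRing (End K W))
    (f : End K (V × W)) (hf : ∀ x : V, (f (x, 0)).2 = 0) : IsNilCleanElem f := by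
  obtain ⟨e, he, k, hk⟩ := hV (LinearMap.fst K V W ∘ₗ f ∘ₗ LinearMap.inl K V W)
  obtain ⟨e', he', l, hl⟩ := hW (LinearMap.snd K V W ∘ₗ f ∘ₗ LinearMap.inr K V W)
  set a := LinearMap.fst K V W ∘ₗ f ∘ₗ LinearMap.inl K V W - e
  set d := LinearMap.snd K V W ∘ₗ f ∘ₗ LinearMap.inr K V W - e'
  set N : End K (V × W) := f - e.prodMap e' with hN
  have h1 : ∀ x : V, N (x, 0) = (a x, 0) := by
    intro x
    ext <;> simp [hN, a, hf]
  have h2 : ∀ z, (N z).2 = d z.2 := by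
    rintro ⟨x, y⟩
    have : (x, y) = (x, (0 : W)) + ((0 : V), y) := by simp
    rw [this, map_add, Prod.snd_add, h1]
    simp [hN, d]
  have h1' : ∀ k, ∀ x : V, (N ^ k) (x, 0) = ((a ^ k) x, 0) := by
    intro k
    induction k with
    | zero => simp
    | succ k ih => intro x; rw [pow_succ, pow_succ, End.mul_apply, h1, ih, End.mul_apply]
  have h2' : ∀ k, ∀ z, ((N ^ k) z).2 = (d ^ k) z.2 := by
    intro k
    induction k with
    | zero => simp
    | succ k ih => intro z; rw [pow_succ, pow_succ, End.mul_apply, ih, h2, End.mul_apply]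
  refine ⟨e.prodMap e', ?_, k + l, LinearMap.ext fun z => ?_⟩
  · refine LinearMap.ext fun z => Prod.ext ?_ ?_
    · exact LinearMap.congr_fun he z.1
    · exact LinearMap.congr_fun he' z.2
  · rw [pow_add, End.mul_apply]
    -- `N ^ l` kills the `W` component, and on `V × 0` the map `N` acts as the nilpotent `a`.
    have h3 : (N ^ l) z = (((N ^ l) z).1, 0) := Prod.ext rfl (by rw [h2', hl]; rfl)
    rw [h3, h1', hk]
    rfl

open Module in
theorem isNilCleanElem_end_of_invariant {K V : Type*} [Field K] [AddCommGroup V] [Module K V]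
    (f : End K V) (W : Submodule K V) (hf : ∀ x ∈ W, f x ∈ W)
    (hW : IsNilCleanRing (End K W))
    (hQ : ∀ U : Submodule K V, IsCompl W U → IsNilCleanRing (End K U)) : IsNilCleanElem f := by
  obtain ⟨U, hU⟩ := W.exists_isCompl
  let φ := Submodule.prodEquivOfIsCompl W U hU
  have h : IsNilCleanElem (φ.symm.conj f) := by
    refine isNilCleanElem_end_prod hW (hQ U hU) _ fun x => ?_
    have : φ.symm.conj f (x, 0) = (⟨f x, hf x x.2⟩, 0) := by
      rw [← Submodule.prodEquivOfIsCompl_symm_apply_left W U hU, LinearEquiv.conj_apply_apply]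
      simp [φ, Submodule.projectionOnto_apply_of_mem_left hU (hf x x.2), hf]
    rw [this]
  have := h.map (φ.conjRingEquiv : End K (W × U) →+* End K V)
  convert this
  ext x
  simp

open Module in
-- Cyclic bases
/-- A sequence with nonzero start has a linearly independent initial segment that spans the
next term. -/
theorem exists_linearIndependent_mem_span {K V : Type*} [Field K] [AddCommGroup V] [Module K V]
    [FiniteDimensional K V] (w : ℕ → V) (h0 : w 0 ≠ 0) :
    ∃ m : ℕ, LinearIndependent K (fun i : Fin (m + 1) => w i) ∧
      w (m + 1) ∈ Submodule.span K (Set.range fun i : Fin (m + 1) => w i) := by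
  by_contra! h
  have key : ∀ m : ℕ, LinearIndependent K (fun i : Fin (m + 1) => w i) := by
    intro m
    induction m with
    | zero =>
      have : Subsingleton (Fin (0 + 1)) := inferInstanceAs (Subsingleton (Fin 1))
      exact LinearIndependent.of_subsingleton (0 : Fin 1) h0
    | succ m ih =>
      have := linearIndependent_finSnoc.mpr ⟨ih, h m ih⟩
      convert this using 1
      ext i
      refine Fin.lastCases ?_ (fun i => ?_) i <;> simp
  have := (key (finrank K V)).fintype_card_le_finrank
  simp at this

-- With `N` the pure shift, `f - N` kills every basis vector but the last, which it sends to `f (w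
-- m)`. The last coordinate of `f (w m)` being 1, that vector is fixed.
open Module in
theorem isNilCleanElem_end_of_shift {K V : Type*} [Field K] [AddCommGroup V] [Module K V]
    {m : ℕ} (w : ℕ → V) (b : Basis (Fin (m + 1)) K V) (hb : ∀ i, b i = w i) (f : End K V)
    (hf : ∀ i < m, f (w i) = w (i + 1)) (hd : b.repr (f (w m)) (Fin.last m) = 1) :
    IsNilCleanElem f := by
  let N : End K V := b.constr K fun i => if i = Fin.last m then 0 else w (i + 1)
  have hN : ∀ i : Fin (m + 1), N (b i) = if i = Fin.last m then 0 else w (i + 1) :=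
    fun i => b.constr_basis K _ i
  have hN0 : N (w m) = 0 := by simpa [hb] using hN (Fin.last m)
  have hN1 : ∀ i < m, N (w i) = w (i + 1) := by
    intro i hi
    have := hN ⟨i, by omega⟩
    rwa [if_neg (by simp [Fin.ext_iff]; omega), hb] at this
  have hE0 : ∀ i < m, (f - N) (w i) = 0 := by
    intro i hi
    rw [LinearMap.sub_apply, hf i hi, hN1 i hi, sub_self]
  have hE1 : (f - N) (w m) = f (w m) := by
    rw [LinearMap.sub_apply, hN0, sub_zero]
  have hE2 : (f - N) (f (w m)) = f (w m) := by
    conv_lhs => rw [← b.sum_repr (f (w m))]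
    rw [map_sum, Fin.sum_univ_castSucc, Finset.sum_eq_zero, hd, one_smul, hb, Fin.val_last, hE1,
      zero_add]
    intro i _
    rw [map_smul, hb, Fin.val_castSucc, hE0 i i.is_lt, smul_zero]
  refine ⟨f - N, b.ext fun i => ?_, ?_⟩
  · rw [End.mul_apply, hb]
    rcases (Nat.lt_succ_iff.mp i.is_lt).lt_or_eq with hi | hi
    · rw [hE0 i hi, map_zero]
    · rw [hi, hE1, hE2]
  · rw [sub_sub_cancel]
    exact LinearMap.isNilpotent_of_basis_fin w b hb N m ⟨1, by simpa using hN0⟩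
      (fun i hi => .inr (hN1 i hi)) le_rfl

-- The extra `w 0` in `f (w 0)` must stay in the idempotent part, so `N` kills `w 0`, and sending `w
-- m` to `d • w 0` removes the `w 0` coordinate of `f (w m)`. Idempotence at `w 0` uses that `w 1`
-- is killed by `f - N`, hence `2 ≤ m`.
open Module in
theorem isNilCleanElem_end_of_shift_add {K V : Type*} [Field K] [AddCommGroup V] [Module K V]
    {m : ℕ} (hm : 2 ≤ m) (w : ℕ → V) (b : Basis (Fin (m + 1)) K V) (hb : ∀ i, b i = w i)
    (f : End K V) (hf0 : f (w 0) = w 1 + w 0)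
    (hf : ∀ i < m, 0 < i → f (w i) = w (i + 1)) (hd : b.repr (f (w m)) (Fin.last m) = 1) :
    IsNilCleanElem f := by
  set d := b.repr (f (w m)) 0
  let N : End K V := b.constr K fun i => if i = 0 then 0 else
    if i = Fin.last m then d • w 0 else w (i + 1)
  have hN : ∀ i : Fin (m + 1), N (b i) = if i = 0 then 0 else
      if i = Fin.last m then d • w 0 else w (i + 1) :=
    fun i => b.constr_basis K _ i
  have hN0 : N (w 0) = 0 := by simpa [hb] using hN 0
  have hNm : N (w m) = d • w 0 := by
    have := hN (Fin.last m)
    rwa [if_neg (by simp [Fin.ext_iff]; omega), if_pos rfl, hb] at this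
  have hN1 : ∀ i < m, 0 < i → N (w i) = w (i + 1) := by
    intro i hi hi0
    have := hN ⟨i, by omega⟩
    rwa [if_neg (by simp [Fin.ext_iff]; omega), if_neg (by simp [Fin.ext_iff]; omega), hb] at this
  have hE0 : (f - N) (w 0) = w 1 + w 0 := by
    rw [LinearMap.sub_apply, hN0, sub_zero, hf0]
  have hE1 : ∀ i < m, 0 < i → (f - N) (w i) = 0 := by
    intro i hi hi0
    rw [LinearMap.sub_apply, hf i hi hi0, hN1 i hi hi0, sub_self]
  have hEm : (f - N) (w m) = f (w m) - d • w 0 := by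
    rw [LinearMap.sub_apply, hNm]
  have hE2 : (f - N) (f (w m) - d • w 0) = f (w m) - d • w 0 := by
    obtain ⟨k, rfl⟩ : ∃ k, m = k + 1 := ⟨m - 1, by omega⟩
    have hy : f (w (k + 1)) - d • w 0 =
        ∑ i : Fin k, b.repr (f (w (k + 1))) i.succ.castSucc • b i.succ.castSucc + w (k + 1) := by
      conv_lhs => rw [← b.sum_repr (f (w (k + 1)))]
      rw [Fin.sum_univ_castSucc, Fin.sum_univ_succ, hd, one_smul, hb (Fin.last _), Fin.val_last,
        hb (Fin.castSucc 0)]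
      simp only [Fin.castSucc_zero, Fin.val_zero, d]
      abel
    rw [← hEm]
    conv_lhs => rw [hEm, hy]
    rw [map_add, map_sum, Finset.sum_eq_zero, zero_add]
    intro i _
    rw [map_smul, hb, hE1 _ (by simp) (by simp), smul_zero]
  refine ⟨f - N, b.ext fun i => ?_, ?_⟩
  · rw [End.mul_apply, hb]
    rcases (Nat.lt_succ_iff.mp i.is_lt).lt_or_eq with hi | hi
    · rcases Nat.eq_zero_or_pos (i : ℕ) with h0 | h0
      · rw [h0, hE0, map_add, hE0, hE1 1 (by omega) one_pos, zero_add]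
      · rw [hE1 i hi h0, map_zero]
    · rw [hi, hEm, hE2]
  · rw [sub_sub_cancel]
    refine LinearMap.isNilpotent_of_basis_fin w b hb N m ⟨2, ?_⟩ (fun i hi => ?_) le_rfl
    · rw [sq, End.mul_apply, hNm, map_smul, hN0, smul_zero]
    · rcases Nat.eq_zero_or_pos i with rfl | h0
      · exact .inl ⟨0, by simpa using hN0⟩
      · exact .inr (hN1 i hi h0)

-- Here `w 1` is already the last vector, so the shift argument breaks down. In characteristic 2 the
-- only unknown entry, the `w 0` coordinate of `f (w 1)`, decides: if it is 0, `f - 1` squares to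
-- zero; if it is 1, `f` does.
open Module in
theorem isNilCleanElem_end_of_shift_add_two {K V : Type*} [Field K] [AddCommGroup V] [Module K V]
    (hK : ∀ x : K, x = 0 ∨ x = 1) (w : ℕ → V) (b : Basis (Fin 2) K V) (hb : ∀ i, b i = w i)
    (f : End K V) (hf0 : f (w 0) = w 1 + w 0) (hd : b.repr (f (w 1)) 1 = 1) :
    IsNilCleanElem f := by
  have h2 : ∀ x : V, x + x = 0 := by
    intro x
    have : (1 : K) + 1 = 0 := (hK (1 + 1)).resolve_right (by simp)
    rw [← one_smul K x, ← add_smul, this, zero_smul]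
  have h2' : ∀ x : V, -x = x := fun x => neg_eq_of_add_eq_zero_left (h2 x)
  have hf1 : f (w 1) = b.repr (f (w 1)) 0 • w 0 + w 1 := by
    conv_lhs => rw [← b.sum_repr (f (w 1))]
    rw [Fin.sum_univ_two, hd, one_smul, hb, hb]
    rfl
  rcases hK (b.repr (f (w 1)) 0) with h | h
  · rw [h, zero_smul, zero_add] at hf1
    refine ⟨1, .one, 2, b.ext fun i => ?_⟩
    rw [hb, sq, End.mul_apply]
    fin_cases i <;> simp [hf0, hf1]
  · rw [h, one_smul] at hf1
    refine IsNilpotent.isNilCleanElem ⟨2, b.ext fun i => ?_⟩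
    rw [hb, sq, End.mul_apply]
    fin_cases i
    · simp only [hf0, map_add, hf1, LinearMap.zero_apply]
      rw [add_comm (w 0), h2]
    · simp only [hf0, map_add, hf1, LinearMap.zero_apply]
      rw [add_comm (w 0), h2]

-- In this basis only the first and last diagonal entries can be nonzero, and the first is `t`.
open Module in
theorem repr_last_eq_trace_sub {K V : Type*} [Field K] [AddCommGroup V] [Module K V]
    {m : ℕ} (w : ℕ → V) (b : Basis (Fin (m + 2)) K V) (hb : ∀ i, b i = w i) (f : End K V) (t : K)
    (hf0 : f (w 0) = w 1 + t • w 0) (hf : ∀ i < m + 1, 0 < i → f (w i) = w (i + 1)) :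
    b.repr (f (w (m + 1))) (Fin.last (m + 1)) = LinearMap.trace K V f - t := by
  have h0 : b.repr (f (b 0)) 0 = t := by
    have h1 : w 1 = b 1 := by rw [hb]; rfl
    have h2 : w 0 = b 0 := by rw [hb]; rfl
    rw [hb, Fin.val_zero, hf0, h1, h2]
    simp
  have h1 : ∀ i : Fin m, b.repr (f (b i.succ.castSucc)) i.succ.castSucc = 0 := by
    intro i
    have h : w (i + 2) = b i.succ.succ := by rw [hb]; rfl
    rw [hb, hf _ (by simp) (by simp), Fin.val_castSucc, Fin.val_succ, h, b.repr_self,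
      Finsupp.single_apply, if_neg]
    simp [Fin.ext_iff]
  rw [LinearMap.trace_eq_matrix_trace K b, Matrix.trace]
  simp only [Matrix.diag_apply, LinearMap.toMatrix_apply]
  rw [Fin.sum_univ_castSucc, Fin.sum_univ_succ, Finset.sum_eq_zero fun i _ => h1 i,
    Fin.castSucc_zero, h0, hb (Fin.last _), Fin.val_last]
  ring

open Module in
theorem isNilCleanRing_end {K : Type*} [Field K] (hK : ∀ x : K, x = 0 ∨ x = 1)
    (V : Type*) [AddCommGroup V] [Module K V] [FiniteDimensional K V] :
    IsNilCleanRing (End K V) := by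
  induction h : finrank K V using Nat.strong_induction_on generalizing V with
  | _ n ih =>
  intro f
  subst h
  rcases subsingleton_or_nontrivial V with hV | hV
  · exact ⟨0, .zero, 0, LinearMap.ext fun _ => Subsingleton.elim _ _⟩
  obtain ⟨v, hv⟩ := exists_ne (0 : V)
  set τ := LinearMap.trace K V f with hτ
  -- The correction at the first step makes the first diagonal entry `1 - τ`, so the last is `τ - (1
  -- - τ) = 2τ - 1`, which is 1 in characteristic 2.
  let w : ℕ → V := fun i => Nat.rec v (fun i x => f x - (if i = 0 then (1 - τ) • v else 0)) i
  have hw0 : w 0 = v := rfl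
  have hf0 : f (w 0) = w 1 + (1 - τ) • w 0 := by simp [w]
  have hf : ∀ i, 0 < i → f (w i) = w (i + 1) := by
    intro i hi
    simp [w, hi.ne']
  obtain ⟨m, hli, hmem⟩ := exists_linearIndependent_mem_span (K := K) w (by rwa [hw0])
  set W := Submodule.span K (Set.range fun i : Fin (m + 1) => w i) with hW
  have hwW : ∀ i ≤ m + 1, w i ∈ W := by
    intro i hi
    rcases hi.lt_or_eq with hi | rfl
    · exact Submodule.subset_span ⟨⟨i, hi⟩, rfl⟩
    · exact hmem
  have hinv : ∀ x ∈ W, f x ∈ W := by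
    intro x hx
    have : W ≤ W.comap f := by
      conv_lhs => rw [hW]
      rw [Submodule.span_le]
      rintro _ ⟨i, rfl⟩
      change f (w i) ∈ W
      rcases Nat.eq_zero_or_pos (i : ℕ) with h0 | h0
      · rw [h0, hf0]
        exact W.add_mem (hwW 1 (by omega)) (W.smul_mem _ (hwW 0 (by omega)))
      · rw [hf i h0]
        exact hwW (i + 1) (by omega)
    exact this hx
  by_cases htop : W = ⊤
  · let b : Basis (Fin (m + 1)) K V := Basis.mk hli htop.ge
    have hb : ∀ i, b i = w i := fun i => Basis.mk_apply hli htop.ge i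
    -- In dimension one, the first and last diagonal entries coincide, so the trace computation does
    -- not apply; `f` is then the scalar 0 or 1.
    obtain _ | m := m
    · have : Subsingleton (Fin (0 + 1)) := inferInstanceAs (Subsingleton (Fin 1))
      have hf' : f = b.repr (f (b 0)) 0 • 1 := by
        refine b.ext fun i => ?_
        rw [Subsingleton.elim i 0]
        conv_lhs => rw [← b.sum_repr (f (b 0))]
        simp
      refine IsIdempotentElem.isNilCleanElem ?_
      rw [hf']
      rcases hK (b.repr (f (b 0)) 0) with h | h <;> simp [h, IsIdempotentElem]
    · have htr := repr_last_eq_trace_sub w b hb f (1 - τ) hf0 fun i _ => hf i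
      have h11 : (1 : K) + 1 = 0 := (hK (1 + 1)).resolve_right (by simp)
      have hd : b.repr (f (w (m + 1))) (Fin.last (m + 1)) = 1 := by
        rw [htr, ← hτ]
        rcases hK τ with h | h <;> rw [h]
        · linear_combination -h11
        · ring
      rcases hK τ with h | h
      · rw [h, sub_zero, one_smul] at hf0
        obtain _ | m := m
        · exact isNilCleanElem_end_of_shift_add_two hK w b hb f hf0 hd
        · exact isNilCleanElem_end_of_shift_add (by omega) w b hb f hf0 (fun i _ => hf i) hd
      · rw [h, sub_self, zero_smul, add_zero] at hf0
        refine isNilCleanElem_end_of_shift w b hb f (fun i _ => ?_) hd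
        rcases Nat.eq_zero_or_pos i with rfl | h0
        · exact hf0
        · exact hf i h0
  -- `W` is proper and contains `v ≠ 0`, so both it and any complement have smaller dimension.
  · have hlt := Submodule.finrank_lt htop
    refine isNilCleanElem_end_of_invariant f W hinv (ih _ hlt W rfl) fun U hU => ih _ ?_ U rfl
    have h1 := Submodule.finrank_add_eq_of_isCompl hU
    have h2 : 0 < finrank K W := by
      have : Nontrivial W := ⟨⟨w 0, hwW 0 (by omega)⟩, 0, fun h => hv (congrArg Subtype.val h)⟩
      exact finrank_pos
    omega

/-! ### Passage back to matrices over `R` -/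

theorem isNilCleanRing_matrix_of_field {K n : Type*} [Field K] [Fintype n] [DecidableEq n]
    (hK : ∀ x : K, x = 0 ∨ x = 1) : IsNilCleanRing (Matrix n n K) :=
  (isNilCleanRing_end hK (n → K)).of_surjective
    (LinearMap.toMatrixAlgEquiv' (R := K) (n := n)).toRingEquiv.toRingHom
    (LinearMap.toMatrixAlgEquiv' (R := K) (n := n)).surjective

theorem IsNilCleanRing.matrix {R n : Type*} [CommRing R] [Fintype n] [DecidableEq n]
    (h : IsNilCleanRing R) : IsNilCleanRing (Matrix n n R) := by
  let π := Ideal.Quotient.mk (nilradical R)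
  have hπ : Function.Surjective π := Ideal.Quotient.mk_surjective
  have hred : IsReduced (R ⧸ nilradical R) :=
    (Ideal.isRadical_iff_quotient_reduced _).mp (Ideal.radical_isRadical ⊥)
  have hB : IsNilCleanRing (Matrix n n (R ⧸ nilradical R)) :=
    isNilCleanRing_matrix_of_boolean (h.of_surjective π hπ).sq_eq_self_of_isReduced
      fun K _ hK => isNilCleanRing_matrix_of_field hK
  intro A
  refine .of_map π.mapMatrix (fun M => ?_) (fun M hM => ?_) (hB _)
  · choose g hg using hπ
    exact ⟨M.map g, Matrix.ext fun i j => hg _⟩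
  · refine Matrix.isNilpotent_of_forall_apply fun i j => ?_
    have : π (M i j) = 0 := congrFun (congrFun hM i) j
    rwa [← RingHom.mem_ker, Ideal.mk_ker] at this

theorem corollary2p8 {R : Type*} [CommRing R] (n : ℕ) (hn : 1 ≤ n) :
    IsNilCleanRing R ↔ IsNilCleanRing (Matrix (Fin n) (Fin n) R) := by
  have : Nonempty (Fin n) := ⟨⟨0, hn⟩⟩
  exact ⟨fun h => h.matrix, isNilCleanRing_of_matrix⟩
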